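/- For a set $\mathcal{A}\subset\mathbb{R}^d$, call $\mathcal{S}t\subset\mathbb{R}^d$ a Steiner tree for $\mathcal{A}$ if $\mathcal{S}t\cup\mathcal{A}$ is connected, $\mathcal{H}^1(\mathcal{S}t)\le\mathcal{H}^1(S)$ for every $S\subset\mathbb{R}^d$ such that $S\cup\mathcal{A}$ is connected, and $\mathcal{S}t$ is itself connected; here $\mathcal{H}^1$ is the one-dimensional Hausdorff measure (length). Let $\mathbb{S}^{d-1}\subset\mathbb{R}^d$ be the unit sphere centred at the origin. **Theorem.** There are real constants $c_d$, depending only on the integer $d>2$, such that for every $d>2$, every $t$ and arbitrary points $a_1,\dots,a_t\in\mathbb{S}^{d-1}$, every Steiner tree $\mathcal{S}t$ for $\{a_1,\dots,a_t\}$ satisfies $$\mathcal{H}^1(\mathcal{S}t)\le c_d\,t^{\frac{d-2}{d-1}}.$$ Moreover, $c_d=2+o(1)$ as $d\to\infty$, and $c_d\le c_3=7.76\dots$ for every $d>2$ (that is, $c_d\le c_3$ and $7.76\le c_3<7.77$). -/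

import Mathlib

open MeasureTheory Filter Topology

/-- `S` is a Steiner set for `A ⊆ ℝ^d`: `S ∪ A` is connected, and `S` has the least one-dimensional
Hausdorff measure among all subsets `S'` of `ℝ^d` for which `S' ∪ A` is connected. A set is
connected when it is not the disjoint union of two non-empty relatively closed subsets; the empty
set is allowed, which is `IsPreconnected` in Mathlib. -/
def IsSteinerSet {d : ℕ} (A S : Set (EuclideanSpace ℝ (Fin d))) : Prop :=
  IsPreconnected (S ∪ A) ∧
    ∀ S' : Set (EuclideanSpace ℝ (Fin d)), IsPreconnected (S' ∪ A) →
      Measure.hausdorffMeasure 1 S ≤ Measure.hausdorffMeasure 1 S'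

/-- A Steiner tree for `A` is a Steiner set for `A` that is itself connected. -/
def IsSteinerTree {d : ℕ} (A S : Set (EuclideanSpace ℝ (Fin d))) : Prop :=
  IsSteinerSet A S ∧ IsPreconnected S

/-! A Steiner tree is no longer than any connected set through the points, so upper bounds come from
explicit competitors.

Greedy tree: if `2u`-separated sets of `n` points on the sphere satisfy `n * u ^ (d-1) ≤ K ^ (d-1)`,
some two of any `n ≥ 2` points are within `2K n ^ (-1/(d-1))`. Deleting one of them and recursing
gives total length at most `2K (d-1)/(d-2) t ^ ((d-2)/(d-1))`.

Two volume arguments supply `K`. Balls packed in a shell give `K = 2 * 2 ^ (1/(d-1))`, enough for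
`7.765` once `d ≥ 4`. Thin ellipsoids packed in the unit ball, one in the Voronoi cone of each
point, give a `K` tending to `1`, hence the limit `2`.

For `d = 3` both are too weak. There the competitor is a spherical spiral with about `√t / 2` turns,
each point being joined to it by a segment of length at most `π / √t`. -/

/-! ### Greedy trees from close pairs -/

section Trees

variable {E : Type*} [NormedAddCommGroup E] [NormedSpace ℝ E] [MeasurableSpace E] [BorelSpace E]

/-- Attaching finitely many points to a preconnected set by segments of length at most `r`. -/
theorem exists_isPreconnected_attach {S : Set E} (hS : IsPreconnected S) (r : ℝ) (A : Finset E)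
    (hA : ∀ x ∈ A, ∃ y ∈ S, dist x y ≤ r) :
    ∃ S' : Set E, S ⊆ S' ∧ (A : Set E) ⊆ S' ∧ IsPreconnected S' ∧
      Measure.hausdorffMeasure 1 S' ≤
        Measure.hausdorffMeasure 1 S + A.card * ENNReal.ofReal r := by
  classical
  induction A using Finset.induction_on with
  | empty => exact ⟨S, subset_rfl, by simp, hS, by simp⟩
  | insert x A hx ih =>
    obtain ⟨S', hSS', hAS', hc, hm⟩ := ih fun z hz => hA z (Finset.mem_insert_of_mem hz)
    obtain ⟨y, hy, hxy⟩ := hA x (Finset.mem_insert_self x A)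
    refine ⟨S' ∪ segment ℝ x y, hSS'.trans Set.subset_union_left, ?_, ?_, ?_⟩
    · rw [Finset.coe_insert]
      exact Set.insert_subset (Or.inr (left_mem_segment ℝ x y))
        (hAS'.trans Set.subset_union_left)
    · exact hc.union y (hSS' hy) (right_mem_segment ℝ x y) (convex_segment x y).isPreconnected
    · calc Measure.hausdorffMeasure 1 (S' ∪ segment ℝ x y)
          ≤ Measure.hausdorffMeasure 1 S' + Measure.hausdorffMeasure 1 (segment ℝ x y) :=
            measure_union_le _ _
        _ ≤ Measure.hausdorffMeasure 1 S + A.card * ENNReal.ofReal r + ENNReal.ofReal r := by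
            gcongr
            rw [hausdorffMeasure_segment, edist_dist]
            exact ENNReal.ofReal_le_ofReal hxy
        _ = _ := by rw [Finset.card_insert_of_notMem hx]; push_cast; ring

/-- If every finite subset of `P` with `n ≥ 2` points contains two points at distance at most
`ρ n`, then every finite subset of `P` lies in a connected set of length at most `∑ ρ n`. -/
theorem exists_isPreconnected_of_close_pairs (P : Set E) (ρ : ℕ → ℝ) (hρ : ∀ n, 0 ≤ ρ n)
    (hpair : ∀ A : Finset E, (A : Set E) ⊆ P → 2 ≤ A.card →
      ∃ x ∈ A, ∃ y ∈ A, x ≠ y ∧ dist x y ≤ ρ A.card) (A : Finset E) (hA : (A : Set E) ⊆ P) :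
    ∃ S : Set E, (A : Set E) ⊆ S ∧ IsPreconnected S ∧
      Measure.hausdorffMeasure 1 S ≤
        ENNReal.ofReal (∑ n ∈ Finset.range A.card, ρ (n + 1)) := by
  classical
  induction hn : A.card generalizing A with
  | zero => exact ⟨∅, by simp [Finset.card_eq_zero.mp hn], isPreconnected_empty, by simp⟩
  | succ n ih =>
    rcases Nat.eq_zero_or_pos n with rfl | hpos
    · obtain ⟨x, rfl⟩ := Finset.card_eq_one.mp hn
      have : NullSingletonClass (Measure.hausdorffMeasure 1 : Measure E) :=
        Measure.nullSingletonClass_hausdorff E one_pos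
      exact ⟨{x}, by simp, isPreconnected_singleton, by simp⟩
    -- Drop `x` from a close pair, span the rest, and hang `x` back on its neighbour `y`.
    · obtain ⟨x, hx, y, hy, hxy, hd⟩ := hpair A hA (by omega)
      obtain ⟨S, hS, hc, hm⟩ := ih (A.erase x)
        ((Finset.coe_subset.mpr (Finset.erase_subset x A)).trans hA)
        (by rw [Finset.card_erase_of_mem hx, hn]; rfl)
      obtain ⟨S', hSS', hxS', hc', hm'⟩ := exists_isPreconnected_attach hc (ρ (n + 1)) {x}
        fun z hz => ⟨y, hS (by simp [hy, hxy.symm]),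
          by rw [Finset.mem_singleton.mp hz, ← hn]; exact hd⟩
      refine ⟨S', fun z hz => ?_, hc', hm'.trans ?_⟩
      · by_cases hzx : z = x
        · exact hxS' (by simp [hzx])
        · exact hSS' (hS (by simpa [hzx] using hz))
      · rw [Finset.sum_range_succ, ENNReal.ofReal_add (Finset.sum_nonneg fun i _ => hρ _) (hρ _)]
        simp only [Finset.card_singleton, Nat.cast_one, one_mul]
        gcongr

end Trees

/-- Integral comparison in discrete form: Bernoulli's inequality for `(1 - 1/k) ^ (1-s)` bounds each
term by an increment of `k ^ (1-s) / (1-s)`. -/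
theorem sum_rpow_neg_le {s : ℝ} (hs0 : 0 ≤ s) (hs1 : s < 1) (n : ℕ) :
    ∑ k ∈ Finset.range n, ((k + 1 : ℕ) : ℝ) ^ (-s) ≤ (n : ℝ) ^ (1 - s) / (1 - s) := by
  have h1s : 0 < 1 - s := by linarith
  induction n with
  | zero => simp [Real.zero_rpow h1s.ne']
  | succ n ih =>
    rw [Finset.sum_range_succ]
    have hpos : (0 : ℝ) < ((n + 1 : ℕ) : ℝ) := by positivity
    have hinv : ((n + 1 : ℕ) : ℝ)⁻¹ ≤ 1 := inv_le_one_of_one_le₀ (by simp)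
    have hb := rpow_one_add_le_one_add_mul_self (s := -((n + 1 : ℕ) : ℝ)⁻¹)
      (by linarith) h1s.le (by linarith)
    have hn : (n : ℝ) = ((n + 1 : ℕ) : ℝ) * (1 + -((n + 1 : ℕ) : ℝ)⁻¹) := by
      field_simp; push_cast; ring
    have hsplit : ((n + 1 : ℕ) : ℝ) ^ (1 - s) =
        ((n + 1 : ℕ) : ℝ) * ((n + 1 : ℕ) : ℝ) ^ (-s) := by
      rw [sub_eq_add_neg, Real.rpow_add hpos, Real.rpow_one]
    have hle : (n : ℝ) ^ (1 - s) ≤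
        ((n + 1 : ℕ) : ℝ) ^ (1 - s) - (1 - s) * ((n + 1 : ℕ) : ℝ) ^ (-s) := by
      calc (n : ℝ) ^ (1 - s)
          = ((n + 1 : ℕ) : ℝ) ^ (1 - s) * (1 + -((n + 1 : ℕ) : ℝ)⁻¹) ^ (1 - s) := by
            conv_lhs => rw [hn]
            rw [Real.mul_rpow hpos.le (by linarith)]
        _ ≤ ((n + 1 : ℕ) : ℝ) ^ (1 - s) * (1 + (1 - s) * -((n + 1 : ℕ) : ℝ)⁻¹) := by gcongr
        _ = _ := by rw [hsplit]; field_simp; ring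
    rw [le_div_iff₀ h1s] at ih ⊢
    linarith

theorem exists_isPreconnected_of_packing {d : ℕ} (hd : 2 < d) {K : ℝ} (hK : 0 ≤ K)
    (hpack : ∀ (A : Finset (EuclideanSpace ℝ (Fin d))) (u : ℝ), 0 < u → u ≤ 1 →
      (A : Set (EuclideanSpace ℝ (Fin d))) ⊆ Metric.sphere 0 1 →
      (∀ x ∈ A, ∀ y ∈ A, x ≠ y → 2 * u ≤ dist x y) → A.card * u ^ (d - 1) ≤ K ^ (d - 1))
    (A : Finset (EuclideanSpace ℝ (Fin d)))
    (hA : (A : Set (EuclideanSpace ℝ (Fin d))) ⊆ Metric.sphere 0 1) :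
    ∃ S : Set (EuclideanSpace ℝ (Fin d)), (A : Set (EuclideanSpace ℝ (Fin d))) ⊆ S ∧
      IsPreconnected S ∧ Measure.hausdorffMeasure 1 S ≤
        ENNReal.ofReal (2 * K * ((d - 1) / (d - 2)) *
          (A.card : ℝ) ^ (((d : ℝ) - 2) / ((d : ℝ) - 1))) := by
  classical
  have hd' : (2 : ℝ) < d := by exact_mod_cast hd
  have hd1 : ((d - 1 : ℕ) : ℝ) = d - 1 := by rw [Nat.cast_sub (by omega)]; simp
  set s : ℝ := 1 / ((d : ℝ) - 1) with hs
  have hs0 : 0 ≤ s := by apply div_nonneg <;> linarith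
  have hs1 : s < 1 := by rw [hs, div_lt_one (by linarith)]; linarith
  obtain ⟨S, hAS, hc, hm⟩ := exists_isPreconnected_of_close_pairs
    (Metric.sphere (0 : EuclideanSpace ℝ (Fin d)) 1) (fun n => 2 * K * (n : ℝ) ^ (-s))
    (fun n => by positivity) (fun B hB hcard => by
      have hne : B.offDiag.Nonempty := by
        obtain ⟨x, hx, y, hy, hxy⟩ := Finset.one_lt_card.mp hcard
        exact ⟨(x, y), by simp [hx, hy, hxy]⟩
      obtain ⟨⟨x, y⟩, hxy, hmin⟩ :=
        Finset.exists_min_image B.offDiag (fun p => dist p.1 p.2) hne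
      obtain ⟨hx, hy, hne⟩ := Finset.mem_offDiag.mp hxy
      refine ⟨x, hx, y, hy, hne, ?_⟩
      have hpos := dist_pos.mpr hne
      have hle : dist x y ≤ 2 := by
        have h1 := Metric.mem_sphere.mp (hB hx)
        have h2 := Metric.mem_sphere.mp (hB hy)
        linarith [dist_triangle_right x y 0]
      -- Half the minimal distance is the packing radius; it is at most `1` because the sphere has
      -- diameter `2`.
      have hp := hpack B (dist x y / 2) (by positivity) (by linarith) hB fun a ha b hb hab => by
        have := hmin (a, b) (by simp [ha, hb, hab])
        simp only at this ⊢
        linarith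
      have hn : (0 : ℝ) < B.card := by exact_mod_cast (by omega : 0 < B.card)
      have hd0 : d - 1 ≠ 0 := by omega
      have key : dist x y / 2 ≤ K * (B.card : ℝ) ^ (-s) := by
        refine le_of_pow_le_pow_left₀ hd0 (by positivity) ?_
        rw [mul_pow, ← Real.rpow_mul_natCast hn.le, hd1, hs,
          show -(1 / ((d : ℝ) - 1)) * (d - 1) = -1 by
            have : (d : ℝ) - 1 ≠ 0 := by linarith
            field_simp, Real.rpow_neg_one, ← div_eq_mul_inv, le_div_iff₀ hn]
        linarith
      linarith) A hA
  refine ⟨S, hAS, hc, hm.trans (ENNReal.ofReal_le_ofReal ?_)⟩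
  rw [← Finset.mul_sum]
  have h1 : 1 - s = ((d : ℝ) - 2) / (d - 1) := by
    have : (d : ℝ) - 1 ≠ 0 := by linarith
    rw [hs]; field_simp; ring
  have h := sum_rpow_neg_le hs0 hs1 A.card
  rw [h1] at h
  calc 2 * K * ∑ k ∈ Finset.range A.card, ((k + 1 : ℕ) : ℝ) ^ (-s)
      ≤ 2 * K * ((A.card : ℝ) ^ (((d : ℝ) - 2) / (d - 1)) / (((d : ℝ) - 2) / (d - 1))) := by gcongr
    _ = _ := by
      have : (d : ℝ) - 1 ≠ 0 := by linarith
      have : (d : ℝ) - 2 ≠ 0 := by linarith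
      field_simp

theorem card_mul_le_measure {ι α : Type*} [MeasurableSpace α] (μ : Measure α) (A : Finset ι)
    (U : ι → Set α) (hU : ∀ i ∈ A, MeasurableSet (U i)) (hd : (A : Set ι).PairwiseDisjoint U)
    {T : Set α} (hT : ∀ i ∈ A, U i ⊆ T) {b : ENNReal} (hb : ∀ i ∈ A, b ≤ μ (U i)) :
    A.card * b ≤ μ T := by
  calc A.card * b = ∑ i ∈ A, b := by simp
    _ ≤ ∑ i ∈ A, μ (U i) := Finset.sum_le_sum hb
    _ = μ (⋃ i ∈ A, U i) := (measure_biUnion_finset hd hU).symm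
    _ ≤ μ T := measure_mono (Set.iUnion₂_subset hT)

/-! ### Ellipsoids and Voronoi cones -/

section AxialScaling

open Module

variable {E : Type*} [NormedAddCommGroup E] [InnerProductSpace ℝ E]

/-- The linear map with factor `β` along the unit vector `a` and factor `γ` orthogonally to it. -/
noncomputable def axialScaling (a : E) (β γ : ℝ) : E →ₗ[ℝ] E :=
  γ • LinearMap.transvection ((β / γ - 1) • (innerₗ E a)) a

theorem axialScaling_apply (a : E) (β : ℝ) {γ : ℝ} (hγ : γ ≠ 0) (x : E) :
    axialScaling a β γ x = γ • x + ((β - γ) * inner ℝ a x) • a := by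
  simp only [axialScaling, LinearMap.smul_apply, LinearMap.transvection.apply, innerₗ_apply_apply,
    smul_add, smul_smul, smul_eq_mul]
  congr 2
  field_simp

theorem det_axialScaling [FiniteDimensional ℝ E] {a : E} (ha : ‖a‖ = 1) (β : ℝ) {γ : ℝ} (hγ : γ ≠ 0)
    (hE : 0 < finrank ℝ E) :
    LinearMap.det (axialScaling a β γ) = β * γ ^ (finrank ℝ E - 1) := by
  rw [axialScaling, LinearMap.det_smul, LinearMap.transvection.det]
  simp only [LinearMap.smul_apply, innerₗ_apply_apply, real_inner_self_eq_norm_sq, ha, smul_eq_mul]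
  obtain ⟨n, hn⟩ := Nat.exists_eq_succ_of_ne_zero hE.ne'
  rw [hn, Nat.succ_sub_one, pow_succ]
  field_simp
  ring

/-- With `θ` the angle between `a` and `b`, the claim follows from `‖w‖ / h < tan (θ/2)`. Separation
gives `sin (θ/2) ≥ u`, while `‖w‖ / h ≤ q u / √(1 - q² u²)`, the tangent of the angle with sine `q u
< u`. -/
theorem inner_lt_inner_of_axial_coordinates {u q h : ℝ} (hu0 : 0 < u) (hu1 : u ≤ 1) (hq0 : 0 < q) (hq1 : q < 1)
    {a b w : E} (ha : ‖a‖ = 1) (hb : ‖b‖ = 1) (hab : 2 * u ≤ dist a b) (haw : inner ℝ a w = (0 : ℝ))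
    (hh : q * √(1 - q ^ 2 * u ^ 2) ≤ h) (hw : ‖w‖ ≤ q ^ 2 * u) :
    inner ℝ b (h • a + w) < (inner ℝ a (h • a + w) : ℝ) := by
  have hq2 : q ^ 2 < 1 := pow_lt_one₀ hq0.le hq1 two_ne_zero
  have hu2 : 0 < u ^ 2 := by positivity
  have hu21 : u ^ 2 ≤ 1 := pow_le_one₀ hu0.le hu1
  have hqu : q ^ 2 * u ^ 2 < u ^ 2 := mul_lt_of_lt_one_left hu2 hq2
  have hv2 : √(1 - q ^ 2 * u ^ 2) ^ 2 = 1 - q ^ 2 * u ^ 2 := Real.sq_sqrt (by linarith)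
  set v : ℝ := √(1 - q ^ 2 * u ^ 2) with hv
  have hv0 : 0 < v := Real.sqrt_pos.mpr (by linarith)
  set c : ℝ := inner ℝ b a with hc
  have hc1 : c ≤ 1 - 2 * u ^ 2 := by
    rw [dist_comm, dist_eq_norm] at hab
    have h4 := pow_le_pow_left₀ (by positivity) hab 2
    have h5 := norm_sub_sq_real b a
    rw [ha, hb] at h5
    linarith
  have hcm : -1 ≤ c := (abs_le.mp ((abs_real_inner_le_norm b a).trans (by rw [ha, hb, one_mul]))).1
  have hcc : 0 ≤ 1 - c ^ 2 := by nlinarith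
  have hbw : inner ℝ b w ≤ ‖w‖ * √(1 - c ^ 2) := by
    have e : inner ℝ b w = (inner ℝ (b - c • a) w : ℝ) := by
      rw [inner_sub_left, inner_smul_left, haw, mul_zero, sub_zero]
    have e2 : ‖b - c • a‖ = √(1 - c ^ 2) := by
      rw [← Real.sqrt_sq (norm_nonneg (b - c • a)), norm_sub_sq_real, inner_smul_right, norm_smul,
        ha, hb, ← hc, mul_one, Real.norm_eq_abs, sq_abs]
      congr 1
      ring
    rw [e, ← e2, mul_comm]
    exact real_inner_le_norm _ _
  rw [inner_add_right, inner_add_right, inner_smul_right, inner_smul_right, haw,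
    real_inner_self_eq_norm_sq, ha, ← hc]
  suffices ‖w‖ * √(1 - c ^ 2) < h * (1 - c) by linarith
  have hc2 : 0 < 1 - c := by linarith
  have h7 : √(1 - c ^ 2) * (q * u) < v * (1 - c) := by
    refine lt_of_pow_lt_pow_left₀ 2 (by positivity) ?_
    rw [mul_pow, mul_pow, mul_pow, Real.sq_sqrt hcc, hv2]
    have h8 : (1 + c) * (q ^ 2 * u ^ 2) < (1 - q ^ 2 * u ^ 2) * (1 - c) := by linarith
    have h9 := mul_lt_mul_of_pos_left h8 hc2
    linarith
  calc ‖w‖ * √(1 - c ^ 2) ≤ q ^ 2 * u * √(1 - c ^ 2) := by gcongr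
    _ = q * (√(1 - c ^ 2) * (q * u)) := by ring
    _ < q * (v * (1 - c)) := by gcongr
    _ = q * v * (1 - c) := by ring
    _ ≤ h * (1 - c) := by gcongr

end AxialScaling

/-! ### Volume bounds for separated sets on the sphere -/

section Packing

variable {E : Type*} [NormedAddCommGroup E] [InnerProductSpace ℝ E] [FiniteDimensional ℝ E]
  [MeasurableSpace E] [BorelSpace E]

open Module

/-- Disjoint balls of radius `u` centred on the unit sphere lie in the shell
`1 - u ≤ ‖x‖ ≤ 1 + u`. -/
theorem card_mul_pow_le_shell [Nontrivial E] (A : Finset E) {u : ℝ} (hu0 : 0 < u) (hu1 : u ≤ 1)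
    (hA : (A : Set E) ⊆ Metric.sphere 0 1) (hsep : ∀ x ∈ A, ∀ y ∈ A, x ≠ y → 2 * u ≤ dist x y) :
    A.card * u ^ finrank ℝ E ≤ (1 + u) ^ finrank ℝ E - (1 - u) ^ finrank ℝ E := by
  let μ : Measure E := Measure.addHaar
  have hB0 : 0 < μ (Metric.ball 0 1) := Metric.measure_ball_pos _ _ one_pos
  have hBt : μ (Metric.ball 0 1) ≠ ⊤ := measure_ball_lt_top.ne
  have h := card_mul_le_measure μ A (fun x => Metric.ball x u)
    (fun _ _ => measurableSet_ball)
    (fun x hx y hy hxy => Metric.ball_disjoint_ball (by linarith [hsep x hx y hy hxy]))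
    (T := Metric.ball 0 (1 + u) \ Metric.ball 0 (1 - u))
    (fun x hx z hz => by
      have h1 := mem_sphere_zero_iff_norm.mp (hA hx)
      rw [Metric.mem_ball, dist_eq_norm] at hz
      have h2 := norm_sub_norm_le z x
      have h3 := norm_sub_norm_le x z
      rw [norm_sub_rev] at h3
      constructor
      · rw [mem_ball_zero_iff]; linarith
      · rw [mem_ball_zero_iff]; linarith)
    (b := ENNReal.ofReal (u ^ finrank ℝ E) * μ (Metric.ball 0 1))
    (fun x _ => (Measure.addHaar_ball μ x hu0.le).ge)
  rw [measure_sdiff (Metric.ball_subset_ball (by linarith)) measurableSet_ball.nullMeasurableSet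
    measure_ball_lt_top.ne, Measure.addHaar_ball μ 0 (by linarith : 0 ≤ 1 + u),
    Measure.addHaar_ball μ 0 (by linarith : 0 ≤ 1 - u), ← mul_assoc,
    ← ENNReal.sub_mul (fun _ _ => hBt), ENNReal.mul_le_mul_iff_left hB0.ne' hBt,
    ← ENNReal.ofReal_sub _ (by positivity), ← ENNReal.ofReal_natCast,
    ← ENNReal.ofReal_mul (by positivity)] at h
  refine (ENNReal.ofReal_le_ofReal_iff ?_).mp h
  exact sub_nonneg.mpr (pow_le_pow_left₀ (by linarith) (by linarith) _)

theorem one_add_pow_sub_one_sub_pow_le {u : ℝ} (hu0 : 0 ≤ u) (hu1 : u ≤ 1) (n : ℕ) :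
    (1 + u) ^ n - (1 - u) ^ n ≤ 2 ^ n * u := by
  rcases n with - | n
  · simpa using hu0
  -- The difference and the sum feed each other in the induction. It starts at exponent `1`, since
  -- the bound on the sum fails at `0`.
  have key : (1 + u) ^ (n + 1) - (1 - u) ^ (n + 1) ≤ 2 ^ (n + 1) * u ∧
      (1 + u) ^ (n + 1) + (1 - u) ^ (n + 1) ≤ 2 ^ (n + 1) := by
    induction n with
    | zero => exact ⟨by norm_num; linarith, by norm_num⟩
    | succ n ih =>
      rw [pow_succ (1 + u) (n + 1), pow_succ (1 - u) (n + 1), pow_succ (2 : ℝ) (n + 1)]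
      have h2 : (0 : ℝ) < 2 ^ (n + 1) := by positivity
      generalize (1 + u) ^ (n + 1) = x at *
      generalize (1 - u) ^ (n + 1) = y at *
      generalize (2 : ℝ) ^ (n + 1) = p at *
      have h3 := mul_le_mul_of_nonneg_left ih.1 hu0
      have h4 := mul_le_mul_of_nonneg_left ih.2 hu0
      have h5 : u * (p * u) ≤ p := by nlinarith [mul_le_one₀ hu1 hu0 hu1]
      constructor <;> linarith
  exact key.1

/-- Disjoint ellipsoids inside the unit ball, each in the Voronoi cell of a point of `A`. -/
theorem card_mul_ellipsoid_le_one (hE : 0 < finrank ℝ E) (A : Finset E) {u q : ℝ} (hu0 : 0 < u)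
    (hu1 : u ≤ 1) (hq0 : 0 < q) (hq1 : q < 1) (hA : (A : Set E) ⊆ Metric.sphere 0 1)
    (hsep : ∀ x ∈ A, ∀ y ∈ A, x ≠ y → 2 * u ≤ dist x y) :
    A.card * ((1 - q) ^ 2 / 2 * (q ^ 2 * u) ^ (finrank ℝ E - 1)) ≤ 1 := by
  let μ : Measure E := Measure.addHaar
  have hB0 : 0 < μ (Metric.ball 0 1) := Metric.measure_ball_pos _ _ one_pos
  have hBt : μ (Metric.ball 0 1) ≠ ⊤ := measure_ball_lt_top.ne
  set v : ℝ := √(1 - q ^ 2 * u ^ 2) with hv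
  have hqu : q ^ 2 * u ^ 2 ≤ q ^ 2 :=
    mul_le_of_le_one_right (sq_nonneg q) (pow_le_one₀ hu0.le hu1)
  have hq2 : q ^ 2 < 1 := by nlinarith
  have hv2 : v ^ 2 = 1 - q ^ 2 * u ^ 2 := Real.sq_sqrt (by linarith)
  have hv0 : 0 < v := Real.sqrt_pos.mpr (by linarith)
  have hvq : 1 - q ≤ v := by
    apply Real.le_sqrt_of_sq_le
    nlinarith
  -- The ellipsoid spans heights `α - β = q v` to `α + β = v` along `a`. Since `v² + (q u)² = 1` and
  -- `γ ≤ q u`, it stays in the unit ball; since `γ / (q v) = q u / v`, it stays in the Voronoi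
  -- cone.
  set α : ℝ := (1 + q) / 2 * v with hα
  set β : ℝ := (1 - q) / 2 * v with hβ
  set γ : ℝ := q ^ 2 * u with hγ
  have hγ0 : 0 < γ := by positivity
  have hβ0 : 0 < β := by apply mul_pos _ hv0; linarith
  let L : E → E →ₗ[ℝ] E := fun a => axialScaling a β γ
  let U : E → Set E := fun a => (fun x => α • a + x) '' (L a '' Metric.ball 0 1)
  have hdet : ∀ a ∈ A, LinearMap.det (L a) = β * γ ^ (finrank ℝ E - 1) := fun a ha =>
    det_axialScaling (mem_sphere_zero_iff_norm.mp (hA ha)) β hγ0.ne' hE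
  have hdpos : 0 < β * γ ^ (finrank ℝ E - 1) := by positivity
  have hopen : ∀ a ∈ A, IsOpen (U a) := fun a ha => by
    apply (Homeomorph.addLeft (α • a)).isOpenMap
    let e := ((L a).equivOfDetNeZero (by rw [hdet a ha]; exact hdpos.ne')).toContinuousLinearEquiv
    exact e.toHomeomorph.isOpenMap _ Metric.isOpen_ball
  have hvol : ∀ a ∈ A, μ (U a) =
      ENNReal.ofReal (β * γ ^ (finrank ℝ E - 1)) * μ (Metric.ball 0 1) := fun a ha => by
    have h1 : μ (U a) = μ (L a '' Metric.ball 0 1) := by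
      simp only [U, Set.image_add_left, measure_preimage_add]
    rw [h1, Measure.addHaar_image_linearMap, hdet a ha, abs_of_pos hdpos]
  -- decomposition of a point of `U a` along `a` and orthogonally to `a`
  have hdec : ∀ a ∈ A, ∀ z ∈ U a, ∃ (h : ℝ) (w : E), z = h • a + w ∧ inner ℝ a w = 0 ∧
      q * v ≤ h ∧ h ≤ v ∧ ‖w‖ ≤ γ := by
    rintro a ha _ ⟨_, ⟨x, hx, rfl⟩, rfl⟩
    have ha1 := mem_sphere_zero_iff_norm.mp (hA ha)
    have haa : inner ℝ a a = (1 : ℝ) := by rw [real_inner_self_eq_norm_sq, ha1, one_pow]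
    have hx1 := mem_ball_zero_iff.mp hx
    have hax : |inner ℝ a x| ≤ 1 := (abs_real_inner_le_norm a x).trans (by rw [ha1]; linarith)
    obtain ⟨hl, hr⟩ := abs_le.mp hax
    refine ⟨α + β * inner ℝ a x, γ • (x - (inner ℝ a x : ℝ) • a), ?_, ?_, ?_, ?_, ?_⟩
    · simp only [L, axialScaling_apply a β hγ0.ne']
      module
    · rw [inner_smul_right, inner_sub_right, inner_smul_right, haa]
      ring
    · have : α - β = q * v := by rw [hα, hβ]; ring
      nlinarith
    · have : α + β = v := by rw [hα, hβ]; ring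
      nlinarith
    · rw [norm_smul, Real.norm_of_nonneg hγ0.le]
      have hp : ‖x - (inner ℝ a x : ℝ) • a‖ ≤ 1 := by
        have : ‖x - (inner ℝ a x : ℝ) • a‖ ^ 2 = ‖x‖ ^ 2 - (inner ℝ a x : ℝ) ^ 2 := by
          rw [norm_sub_sq_real, inner_smul_right, real_inner_comm, norm_smul, ha1, mul_one,
            Real.norm_eq_abs, sq_abs]
          ring
        nlinarith [norm_nonneg x, norm_nonneg (x - (inner ℝ a x : ℝ) • a), sq_nonneg (inner ℝ a x)]
      nlinarith
  have hsub : ∀ a ∈ A, U a ⊆ Metric.closedBall 0 1 := fun a ha z hz => by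
    obtain ⟨h, w, rfl, haw, h1, h2, h3⟩ := hdec a ha z hz
    have ha1 := mem_sphere_zero_iff_norm.mp (hA ha)
    rw [mem_closedBall_zero_iff, ← sq_le_one_iff₀ (norm_nonneg _), norm_add_sq_real,
      inner_smul_left, haw, norm_smul, ha1, mul_one, Real.norm_eq_abs, sq_abs]
    have h0 : 0 ≤ h := le_trans (by positivity) h1
    have e1 : h ^ 2 ≤ v ^ 2 := pow_le_pow_left₀ h0 h2 2
    have e2 : ‖w‖ ^ 2 ≤ γ ^ 2 := pow_le_pow_left₀ (norm_nonneg _) h3 2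
    have e3 : γ ^ 2 ≤ q ^ 2 * u ^ 2 := by
      rw [hγ]
      nlinarith [mul_le_mul_of_nonneg_right hq2.le (by positivity : 0 ≤ q ^ 2 * u ^ 2)]
    simp only [mul_zero]
    linarith
  have hvor : ∀ a ∈ A, ∀ b ∈ A, a ≠ b → ∀ z ∈ U a, inner ℝ b z < (inner ℝ a z : ℝ) := by
    intro a ha b hb hab z hz
    obtain ⟨h, w, rfl, haw, h1, -, h3⟩ := hdec a ha z hz
    exact inner_lt_inner_of_axial_coordinates hu0 hu1 hq0 hq1 (mem_sphere_zero_iff_norm.mp (hA ha))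
      (mem_sphere_zero_iff_norm.mp (hA hb)) (hsep a ha b hb hab) haw h1 h3
  have hdisj : (A : Set E).PairwiseDisjoint U := fun a ha b hb hab =>
    Set.disjoint_left.mpr fun z hza hzb =>
      lt_asymm (hvor a ha b hb hab z hza) (hvor b hb a ha hab.symm z hzb)
  have h := card_mul_le_measure μ A U (fun a ha => (hopen a ha).measurableSet) hdisj hsub
    (fun a ha => (hvol a ha).ge)
  rw [Measure.addHaar_closedBall μ 0 zero_le_one, one_pow, ← mul_assoc,
    ENNReal.mul_le_mul_iff_left hB0.ne' hBt, ← ENNReal.ofReal_natCast,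
    ← ENNReal.ofReal_mul (by positivity), ENNReal.ofReal_le_ofReal_iff zero_le_one] at h
  refine le_trans ?_ h
  have : (1 - q) ^ 2 / 2 ≤ β := by
    rw [hβ]
    nlinarith
  gcongr

end Packing

/-! ### The spherical spiral in dimension three -/

open Real in
/-- A spherical spiral from the north to the south pole, parametrised by the colatitude `x`; its
longitude is `m * x`. -/
noncomputable def sphericalSpiral (m x : ℝ) : EuclideanSpace ℝ (Fin 3) :=
  !₂[sin x * cos (m * x), sin x * sin (m * x), cos x]

/-- The squared chord is `2(1 - cos(x-y)) + 2 sin x sin y (1 - cos(m(x-y)))`; use `sin x sin y ≤ 1`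
and `1 - cos z ≤ z²/2`. -/
theorem dist_sphericalSpiral_le {m : ℝ} (x y : ℝ) :
    dist (sphericalSpiral m x) (sphericalSpiral m y) ≤ √(1 + m ^ 2) * |x - y| := by
  have hcos : ∀ z : ℝ, 1 - Real.cos z ≤ z ^ 2 / 2 := fun z => by
    linarith [Real.one_sub_sq_div_two_le_cos (x := z)]
  rw [EuclideanSpace.dist_eq, ← Real.sqrt_sq_eq_abs, ← Real.sqrt_mul (by positivity)]
  apply Real.sqrt_le_sqrt
  simp only [sphericalSpiral, Fin.sum_univ_three, Real.dist_eq, sq_abs]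
  simp
  have h1 := hcos (x - y)
  have h2 := hcos (m * x - m * y)
  rw [Real.cos_sub] at h1 h2
  have h3 : Real.sin x * Real.sin y ≤ 1 := by
    nlinarith [sq_nonneg (Real.sin x - Real.sin y), Real.sin_sq_le_one x, Real.sin_sq_le_one y]
  have h4 : 0 ≤ 1 - (Real.cos (m * x) * Real.cos (m * y) + Real.sin (m * x) * Real.sin (m * y)) := by
    rw [← Real.cos_sub]; linarith [Real.cos_le_one (m * x - m * y)]
  have h5 := mul_le_mul_of_nonneg_right h3 h4
  have e1 := Real.sin_sq_add_cos_sq x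
  have e2 := Real.sin_sq_add_cos_sq y
  have e3 := Real.sin_sq_add_cos_sq (m * x)
  have e4 := Real.sin_sq_add_cos_sq (m * y)
  have e5 : (Real.sin x * Real.cos (m * x) - Real.sin y * Real.cos (m * y)) ^ 2 +
      (Real.sin x * Real.sin (m * x) - Real.sin y * Real.sin (m * y)) ^ 2 +
      (Real.cos x - Real.cos y) ^ 2 =
      2 * (1 - (Real.cos x * Real.cos y + Real.sin x * Real.sin y)) + 2 * (Real.sin x * Real.sin y *
        (1 - (Real.cos (m * x) * Real.cos (m * y) + Real.sin (m * x) * Real.sin (m * y)))) := by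
    linear_combination e1 + e2 + Real.sin x ^ 2 * e3 + Real.sin y ^ 2 * e4
  rw [e5]
  nlinarith

/-- Distance along a common meridian. -/
theorem dist_meridian_le (l x y : ℝ) :
    dist (!₂[Real.sin x * Real.cos l, Real.sin x * Real.sin l, Real.cos x] :
      EuclideanSpace ℝ (Fin 3)) !₂[Real.sin y * Real.cos l, Real.sin y * Real.sin l, Real.cos y]
      ≤ |x - y| := by
  rw [EuclideanSpace.dist_eq, ← Real.sqrt_sq_eq_abs]
  apply Real.sqrt_le_sqrt
  simp only [Fin.sum_univ_three, Real.dist_eq, sq_abs]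
  simp
  have h1 := Real.one_sub_sq_div_two_le_cos (x := x - y)
  rw [Real.cos_sub] at h1
  nlinarith [Real.sin_sq_add_cos_sq x, Real.sin_sq_add_cos_sq y, Real.sin_sq_add_cos_sq l,
    congrArg (fun z => (Real.sin x - Real.sin y) ^ 2 * z) (Real.sin_sq_add_cos_sq l)]

theorem exists_spherical_coordinates {p : EuclideanSpace ℝ (Fin 3)}
    (hp : p ∈ Metric.sphere (0 : EuclideanSpace ℝ (Fin 3)) 1) :
    ∃ x ∈ Set.Icc 0 Real.pi, ∃ l : ℝ,
      p = !₂[Real.sin x * Real.cos l, Real.sin x * Real.sin l, Real.cos x] := by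
  have hn : p 0 ^ 2 + p 1 ^ 2 + p 2 ^ 2 = 1 := by
    have h := EuclideanSpace.norm_sq_eq p
    rw [mem_sphere_zero_iff_norm.mp hp, Fin.sum_univ_three] at h
    simpa using h.symm
  have hz : -1 ≤ p 2 ∧ p 2 ≤ 1 := abs_le.mp ((sq_le_one_iff_abs_le_one _).mp (by nlinarith))
  set w : ℂ := ⟨p 0, p 1⟩ with hw
  have hsin : Real.sin (Real.arccos (p 2)) = ‖w‖ := by
    rw [Real.sin_arccos, Complex.norm_eq_sqrt_sq_add_sq]
    congr 1
    simp only [hw]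
    linarith
  refine ⟨Real.arccos (p 2), ⟨Real.arccos_nonneg _, Real.arccos_le_pi _⟩, w.arg, ?_⟩
  have hc : ‖w‖ * Real.cos w.arg = p 0 := Complex.norm_mul_cos_arg w
  have hs : ‖w‖ * Real.sin w.arg = p 1 := Complex.norm_mul_sin_arg w
  rw [hsin, hc, hs, Real.cos_arccos hz.1 hz.2]
  ext i
  fin_cases i <;> rfl

theorem exists_dist_sphericalSpiral_le {m : ℝ} (hm : 0 < m) {p : EuclideanSpace ℝ (Fin 3)}
    (hp : p ∈ Metric.sphere (0 : EuclideanSpace ℝ (Fin 3)) 1) :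
    ∃ x ∈ Set.Icc 0 Real.pi, dist p (sphericalSpiral m x) ≤ Real.pi / m := by
  obtain ⟨x, hx, l, rfl⟩ := exists_spherical_coordinates hp
  have hpi := Real.pi_pos
  -- The spiral meets each meridian at colatitudes `2π/m` apart, so one is within `π/m`. Near a pole
  -- that crossing may leave `[0, π]`, and the pole itself, an endpoint of the spiral, serves
  -- instead.
  by_cases h0 : x ≤ Real.pi / m
  · refine ⟨0, ⟨le_rfl, hpi.le⟩, ?_⟩
    have := dist_meridian_le l x 0
    simp only [Real.sin_zero, zero_mul, sub_zero, abs_of_nonneg hx.1] at this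
    simpa [sphericalSpiral] using this.trans h0
  by_cases h1 : Real.pi - x ≤ Real.pi / m
  · refine ⟨Real.pi, ⟨hpi.le, le_rfl⟩, ?_⟩
    have := dist_meridian_le l x Real.pi
    rw [abs_sub_comm, abs_of_nonneg (by linarith [hx.2] : 0 ≤ Real.pi - x)] at this
    simp only [Real.sin_pi, zero_mul] at this
    simpa [sphericalSpiral] using this.trans h1
  push Not at h0 h1
  -- the spiral point on the meridian of `p` closest to `p`
  set n : ℤ := round ((m * x - l) / (2 * Real.pi)) with hn
  have hr := abs_sub_round ((m * x - l) / (2 * Real.pi))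
  rw [← hn] at hr
  set y : ℝ := (l + n * (2 * Real.pi)) / m with hy
  have hmy : m * y = l + n * (2 * Real.pi) := by rw [hy]; field_simp
  have hxy : |x - y| ≤ Real.pi / m := by
    have e : x - y = ((m * x - l) / (2 * Real.pi) - n) * (2 * Real.pi / m) := by
      rw [hy]; field_simp; ring
    rw [e, abs_mul, abs_of_pos (by positivity : 0 < 2 * Real.pi / m)]
    calc _ ≤ 1 / 2 * (2 * Real.pi / m) := by gcongr
      _ = _ := by ring
  have hxy' := abs_le.mp hxy
  refine ⟨y, ⟨by linarith, by linarith⟩, ?_⟩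
  rw [sphericalSpiral, hmy, Real.cos_add_int_mul_two_pi, Real.sin_add_int_mul_two_pi]
  exact (dist_meridian_le l x y).trans hxy

theorem hausdorffMeasure_sphericalSpiral_le (m : ℝ) :
    Measure.hausdorffMeasure 1 (sphericalSpiral m '' Set.Icc 0 Real.pi) ≤
      ENNReal.ofReal (√(1 + m ^ 2) * Real.pi) := by
  have hL : LipschitzWith (Real.toNNReal √(1 + m ^ 2)) (sphericalSpiral m) :=
    LipschitzWith.of_dist_le_mul fun x y => by
      rw [Real.coe_toNNReal _ (Real.sqrt_nonneg _), Real.dist_eq]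
      exact dist_sphericalSpiral_le x y
  refine (hL.hausdorffMeasure_image_le zero_le_one _).trans ?_
  rw [hausdorffMeasure_real, Real.volume_Icc, sub_zero, ENNReal.rpow_one,
    ENNReal.ofReal_mul (Real.sqrt_nonneg _)]
  rfl

theorem isPreconnected_sphericalSpiral (m : ℝ) :
    IsPreconnected (sphericalSpiral m '' Set.Icc 0 Real.pi) := by
  refine isPreconnected_Icc.image _ (LipschitzWith.of_dist_le_mul
    (K := Real.toNNReal √(1 + m ^ 2)) fun x y => ?_).continuous.continuousOn
  rw [Real.coe_toNNReal _ (Real.sqrt_nonneg _), Real.dist_eq]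
  exact dist_sphericalSpiral_le x y

/-! ### Length bounds for Steiner trees -/

theorem IsSteinerTree.hausdorffMeasure_le {d : ℕ} {A S S' : Set (EuclideanSpace ℝ (Fin d))}
    (hS : IsSteinerTree A S) (hA : A ⊆ S') (hS' : IsPreconnected S') :
    Measure.hausdorffMeasure 1 S ≤ Measure.hausdorffMeasure 1 S' :=
  hS.1.2 S' (by rwa [Set.union_eq_self_of_subset_right hA])

theorem IsSteinerTree.hausdorffMeasure_le_of_packing {d : ℕ} (hd : 2 < d) {K : ℝ} (hK : 0 ≤ K)
    (hpack : ∀ (A : Finset (EuclideanSpace ℝ (Fin d))) (u : ℝ), 0 < u → u ≤ 1 →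
      (A : Set (EuclideanSpace ℝ (Fin d))) ⊆ Metric.sphere 0 1 →
      (∀ x ∈ A, ∀ y ∈ A, x ≠ y → 2 * u ≤ dist x y) → A.card * u ^ (d - 1) ≤ K ^ (d - 1))
    {t : ℕ} {a : Fin t → EuclideanSpace ℝ (Fin d)} (ha : ∀ i, a i ∈ Metric.sphere 0 1)
    {S : Set (EuclideanSpace ℝ (Fin d))} (hS : IsSteinerTree (Set.range a) S) :
    Measure.hausdorffMeasure 1 S ≤ ENNReal.ofReal (2 * K * ((d - 1) / (d - 2)) *
      (t : ℝ) ^ (((d : ℝ) - 2) / ((d : ℝ) - 1))) := by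
  classical
  have hd' : (2 : ℝ) < d := by exact_mod_cast hd
  have hco : ((Finset.univ.image a : Finset _) : Set (EuclideanSpace ℝ (Fin d))) = Set.range a := by
    simp
  obtain ⟨S', h1, h2, h3⟩ := exists_isPreconnected_of_packing hd hK hpack (Finset.univ.image a)
    (by rw [hco]; exact Set.range_subset_iff.mpr ha)
  rw [hco] at h1
  refine (hS.hausdorffMeasure_le h1 h2).trans (h3.trans (ENNReal.ofReal_le_ofReal ?_))
  have hcard : (((Finset.univ.image a).card : ℕ) : ℝ) ≤ t := by
    exact_mod_cast Finset.card_image_le.trans (by simp)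
  have hm1 : 0 ≤ (d : ℝ) - 1 := by linarith
  have hm2 : 0 ≤ (d : ℝ) - 2 := by linarith
  gcongr

theorem IsSteinerTree.hausdorffMeasure_le_shell {d : ℕ} (hd : 3 < d) {t : ℕ}
    {a : Fin t → EuclideanSpace ℝ (Fin d)} (ha : ∀ i, a i ∈ Metric.sphere 0 1)
    {S : Set (EuclideanSpace ℝ (Fin d))} (hS : IsSteinerTree (Set.range a) S) :
    Measure.hausdorffMeasure 1 S ≤
      ENNReal.ofReal (7.765 * (t : ℝ) ^ (((d : ℝ) - 2) / ((d : ℝ) - 1))) := by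
  have hd' : (4 : ℝ) ≤ d := by exact_mod_cast hd
  have hd1 : ((d - 1 : ℕ) : ℝ) = d - 1 := by rw [Nat.cast_sub (by omega)]; simp
  have : Nontrivial (EuclideanSpace ℝ (Fin d)) := by
    have : Nonempty (Fin d) := ⟨⟨0, by omega⟩⟩
    infer_instance
  -- The case `d = 4` is the worst: `2 ^ (1/3) < 1.29`, and later `(d-1)/(d-2) ≤ 3/2`.
  have hroot : (2 : ℝ) ^ (1 / ((d : ℝ) - 1)) ≤ 1.29 := by
    calc (2 : ℝ) ^ (1 / ((d : ℝ) - 1)) ≤ 2 ^ (1 / (3 : ℝ)) := by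
          apply Real.rpow_le_rpow_of_exponent_le one_le_two
          apply one_div_le_one_div_of_le <;> linarith
      _ ≤ 1.29 := by
          refine le_of_pow_le_pow_left₀ three_ne_zero (by norm_num) ?_
          rw [← Real.rpow_mul_natCast zero_le_two]
          norm_num
  refine (hS.hausdorffMeasure_le_of_packing (K := 2 * 2 ^ (1 / ((d : ℝ) - 1))) (by omega)
    (by positivity) (fun A u hu0 hu1 hA hsep => ?_) ha).trans (ENNReal.ofReal_le_ofReal ?_)
  · have h := (card_mul_pow_le_shell A hu0 hu1 hA hsep).trans
      (one_add_pow_sub_one_sub_pow_le hu0.le hu1 _)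
    rw [finrank_euclideanSpace_fin] at h
    rw [mul_pow, ← Real.rpow_mul_natCast zero_le_two, hd1,
      one_div_mul_cancel (by linarith : (d : ℝ) - 1 ≠ 0), Real.rpow_one]
    obtain ⟨n, rfl⟩ : ∃ n, d = n + 1 := ⟨d - 1, by omega⟩
    simp only [Nat.add_sub_cancel, pow_succ] at h ⊢
    refine le_of_mul_le_mul_right ?_ hu0
    linarith
  · gcongr
    have hr : ((d : ℝ) - 1) / (d - 2) ≤ 3 / 2 := by
      rw [div_le_div_iff₀ (by linarith) two_pos]
      linarith
    have hr0 : 0 ≤ ((d : ℝ) - 1) / (d - 2) := by apply div_nonneg <;> linarith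
    calc 2 * (2 * 2 ^ (1 / ((d : ℝ) - 1))) * (((d : ℝ) - 1) / (d - 2))
        ≤ 2 * (2 * 1.29) * (3 / 2) := by gcongr
      _ ≤ 7.765 := by norm_num

/-- The constant obtained from packing ellipsoids; it tends to `2`. -/
noncomputable def ellipsoidConstant (d : ℕ) : ℝ :=
  2 * ((2 : ℝ) ^ (1 / ((d : ℝ) - 1)) * ((d : ℝ) ^ (1 / ((d : ℝ) - 1))) ^ 2 /
    (1 - 1 / (d : ℝ)) ^ 2) * (((d : ℝ) - 1) / (d - 2))

/-- The ellipsoid packing is used with `q = 1 - 1/d`: then `q²` tends to `1`, while the volume loss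
`(1-q)²/2 = 1/(2d²)` is harmless after a `(d-1)`-th root. -/
theorem IsSteinerTree.hausdorffMeasure_le_ellipsoid {d : ℕ} (hd : 2 < d) {t : ℕ}
    {a : Fin t → EuclideanSpace ℝ (Fin d)} (ha : ∀ i, a i ∈ Metric.sphere 0 1)
    {S : Set (EuclideanSpace ℝ (Fin d))} (hS : IsSteinerTree (Set.range a) S) :
    Measure.hausdorffMeasure 1 S ≤
      ENNReal.ofReal (ellipsoidConstant d * (t : ℝ) ^ (((d : ℝ) - 2) / ((d : ℝ) - 1))) := by
  have hd' : (2 : ℝ) < d := by exact_mod_cast hd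
  have hd1 : ((d - 1 : ℕ) : ℝ) = d - 1 := by rw [Nat.cast_sub (by omega)]; simp
  have hdne : (d : ℝ) - 1 ≠ 0 := by linarith
  have hq0 : 0 < 1 - 1 / (d : ℝ) := by
    rw [sub_pos, div_lt_one (by linarith)]
    linarith
  have hq1 : 1 - 1 / (d : ℝ) < 1 := by
    have : 0 < 1 / (d : ℝ) := by positivity
    linarith
  refine hS.hausdorffMeasure_le_of_packing hd (by positivity) (fun A u hu0 hu1 hA hsep => ?_) ha
  have h := card_mul_ellipsoid_le_one (by rw [finrank_euclideanSpace_fin]; omega) A hu0 hu1 hq0 hq1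
    hA hsep
  rw [finrank_euclideanSpace_fin, mul_pow (_ ^ 2) u, sub_sub_cancel] at h
  rw [div_pow, mul_pow, ← Real.rpow_mul_natCast zero_le_two, ← pow_mul, mul_comm 2 (d - 1), pow_mul,
    ← Real.rpow_mul_natCast (by positivity), hd1, one_div_mul_cancel hdne, Real.rpow_one,
    Real.rpow_one, le_div_iff₀ (by positivity)]
  have hd2 : (0 : ℝ) < d ^ 2 := by positivity
  calc _ = (2 * (d : ℝ) ^ 2) * (A.card * ((1 / (d : ℝ)) ^ 2 / 2 *
        (((1 - 1 / (d : ℝ)) ^ 2) ^ (d - 1) * u ^ (d - 1)))) := by field_simp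
    _ ≤ 2 * (d : ℝ) ^ 2 * 1 := by gcongr
    _ = _ := mul_one _

theorem tendsto_ellipsoidConstant : Tendsto ellipsoidConstant atTop (𝓝 2) := by
  have hcast : Tendsto (fun d : ℕ => (d : ℝ)) atTop atTop := tendsto_natCast_atTop_atTop
  have hsub : ∀ b : ℝ, Tendsto (fun d : ℕ => (d : ℝ) - b) atTop atTop := fun b =>
    tendsto_atTop_add_const_right _ (-b) hcast
  have hinv : ∀ b : ℝ, Tendsto (fun d : ℕ => 1 / ((d : ℝ) - b)) atTop (𝓝 0) := fun b =>
    (hsub b).const_div_atTop 1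
  have h1 : Tendsto (fun d : ℕ => (2 : ℝ) ^ (1 / ((d : ℝ) - 1))) atTop (𝓝 1) := by
    simpa using tendsto_const_nhds (x := (2 : ℝ)).rpow (hinv 1) (Or.inl two_ne_zero)
  have h2 : Tendsto (fun d : ℕ => (d : ℝ) ^ (1 / ((d : ℝ) - 1))) atTop (𝓝 1) := by
    have := (tendsto_rpow_div_mul_add 1 1 (-1) one_ne_zero.symm).comp hcast
    refine this.congr fun d => ?_
    simp [sub_eq_add_neg]
  have h3 : Tendsto (fun d : ℕ => 1 - 1 / (d : ℝ)) atTop (𝓝 1) := by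
    simpa using (hinv 0).const_sub 1
  have h4 : Tendsto (fun d : ℕ => ((d : ℝ) - 1) / (d - 2)) atTop (𝓝 1) := by
    have : Tendsto (fun d : ℕ => 1 + 1 / ((d : ℝ) - 2)) atTop (𝓝 1) := by
      simpa using (hinv 2).const_add 1
    refine this.congr' ?_
    filter_upwards [eventually_gt_atTop 2] with d hd
    have hd' : (d : ℝ) - 2 ≠ 0 := sub_ne_zero.mpr (by exact_mod_cast hd.ne')
    field_simp
    ring
  have h := ((((h1.mul (h2.pow 2)).div (h3.pow 2) (by norm_num)).const_mul 2).mul h4)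
  norm_num at h
  refine h.congr fun d => ?_
  simp [ellipsoidConstant]

theorem IsSteinerTree.hausdorffMeasure_le_spiral {t : ℕ}
    {a : Fin t → EuclideanSpace ℝ (Fin 3)} (ha : ∀ i, a i ∈ Metric.sphere 0 1)
    {S : Set (EuclideanSpace ℝ (Fin 3))} (hS : IsSteinerTree (Set.range a) S) :
    Measure.hausdorffMeasure 1 S ≤ ENNReal.ofReal (7.765 * √t) := by
  classical
  rcases Nat.lt_or_ge t 2 with ht | ht
  -- For at most one point the empty set is a competitor of length `0`; `t ≥ 2` is what makes
  -- `√(1+t) ≤ (5/4) √t` below.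
  · have hsub : (Set.range a).Subsingleton := by
      have : Subsingleton (Fin t) := Fin.subsingleton_iff_le_one.mpr (by omega)
      exact Set.subsingleton_range a
    have h := hS.1.2 ∅ (by rw [Set.empty_union]; exact hsub.isPreconnected)
    rw [measure_empty] at h
    exact h.trans zero_le
  have ht' : (2 : ℝ) ≤ t := by exact_mod_cast ht
  have hm : 0 < √(t : ℝ) := Real.sqrt_pos.mpr (by linarith)
  have hsq : √(t : ℝ) ^ 2 = t := Real.sq_sqrt (by linarith)
  set m : ℝ := √(t : ℝ) with hm_def
  have hpi := Real.pi_pos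
  have hco : ((Finset.univ.image a : Finset _) : Set (EuclideanSpace ℝ (Fin 3))) = Set.range a := by
    simp
  obtain ⟨S', -, h2, h3, h4⟩ := exists_isPreconnected_attach (isPreconnected_sphericalSpiral m)
    (Real.pi / m) (Finset.univ.image a) (fun p hp => by
      obtain ⟨i, -, rfl⟩ := Finset.mem_image.mp hp
      obtain ⟨x, hx, hd⟩ := exists_dist_sphericalSpiral_le hm (ha i)
      exact ⟨_, Set.mem_image_of_mem _ hx, hd⟩)
  rw [hco] at h2
  refine (hS.hausdorffMeasure_le h2 h3).trans (h4.trans ?_)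
  have hcard : (Finset.univ.image a).card ≤ t := Finset.card_image_le.trans (by simp)
  calc _ ≤ ENNReal.ofReal (√(1 + m ^ 2) * Real.pi) + (t : ENNReal) * ENNReal.ofReal (Real.pi / m) := by
        gcongr
        exact hausdorffMeasure_sphericalSpiral_le m
    _ = ENNReal.ofReal (√(1 + m ^ 2) * Real.pi + t * (Real.pi / m)) := by
        rw [ENNReal.ofReal_add (by positivity) (by positivity), ENNReal.ofReal_mul (Nat.cast_nonneg t),
          ENNReal.ofReal_natCast]
    _ ≤ ENNReal.ofReal (7.765 * m) := by
        apply ENNReal.ofReal_le_ofReal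
        have h5 : √(1 + m ^ 2) ≤ 5 / 4 * m := by
          refine Real.sqrt_le_iff.mpr ⟨by positivity, ?_⟩
          nlinarith
        have h6 : (t : ℝ) * (Real.pi / m) = Real.pi * m := by
          rw [← hsq]; field_simp
        rw [h6]
        calc √(1 + m ^ 2) * Real.pi + Real.pi * m ≤ 5 / 4 * m * Real.pi + Real.pi * m := by gcongr
          _ = 9 / 4 * Real.pi * m := by ring
          _ ≤ 7.765 * m := by
            gcongr
            linarith [Real.pi_lt_d2]

theorem theorem2p3 :
    ∃ c : ℕ → ℝ,
      (∀ d : ℕ, 2 < d → ∀ (t : ℕ) (a : Fin t → EuclideanSpace ℝ (Fin d)),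
        (∀ i, a i ∈ Metric.sphere (0 : EuclideanSpace ℝ (Fin d)) 1) →
        ∀ S : Set (EuclideanSpace ℝ (Fin d)), IsSteinerTree (Set.range a) S →
          Measure.hausdorffMeasure 1 S ≤
            ENNReal.ofReal (c d * (t : ℝ) ^ (((d : ℝ) - 2) / ((d : ℝ) - 1)))) ∧
      Tendsto c atTop (𝓝 2) ∧
      (∀ d : ℕ, 2 < d → c d ≤ c 3) ∧
      (7.76 ≤ c 3 ∧ c 3 < 7.77) := by
  -- The number `7.765` lies in the required window and exceeds both the spiral constant `9π/4` and
  -- the shell constant for `d ≥ 4`. The minimum forces `c d ≤ c 3` without changing the limit.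
  refine ⟨fun d => if d = 3 then 7.765 else min 7.765 (ellipsoidConstant d), ?_, ?_, ?_, ?_⟩
  · intro d hd t a ha S hS
    beta_reduce
    by_cases h3 : d = 3
    · subst h3
      have h := hS.hausdorffMeasure_le_spiral ha
      rw [if_pos rfl, show (((3 : ℕ) : ℝ) - 2) / (((3 : ℕ) : ℝ) - 1) = 1 / 2 by norm_num,
        ← Real.sqrt_eq_rpow]
      exact h
    · rw [if_neg h3]
      rcases min_choice (7.765 : ℝ) (ellipsoidConstant d) with h | h <;> rw [h]
      · exact hS.hausdorffMeasure_le_shell (by omega) ha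
      · exact hS.hausdorffMeasure_le_ellipsoid hd ha
  · have h : Tendsto (fun d => min (7.765 : ℝ) (ellipsoidConstant d)) atTop (𝓝 2) := by
      have := tendsto_const_nhds (x := (7.765 : ℝ)).min tendsto_ellipsoidConstant
      rwa [min_eq_right (by norm_num)] at this
    refine h.congr' ?_
    filter_upwards [eventually_ne_atTop 3] with d hd
    rw [if_neg hd]
  · intro d _
    simp only [if_true]
    split_ifs
    · exact le_rfl
    · exact min_le_left _ _
  · norm_num
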